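/- Let $d\ge 3$. For vectors $v_0,\dots,v_d\in\mathbb R^d$ write $\mathrm{pos}(v_0,\dots,v_d)=\{\sum_{j=0}^d\lambda_j v_j:\lambda_0,\dots,\lambda_d\ge 0\}$, and for a cone $C\subset\mathbb R^d$ of this form let $\alpha_d(C)=\mathbb P[Z\in C]$ be its solid angle, where $Z$ is uniformly distributed on the unit sphere of $\mathbb R^d$ (so that the full solid angle is $\alpha_d(\mathbb R^d)=1$). For a simplex $S=\mathrm{conv}(x_0,\dots,x_d)\subset\mathbb R^d$ with affinely independent vertices $x_0,\dots,x_d$, let $$\gamma_d(S)=\sum_{i=0}^d \alpha_d\big(\mathrm{pos}(x_0-x_i,\dots,x_d-x_i)\big)$$ be the sum of its solid angles. A simplex is called non-degenerate if it has non-empty interior. Then every non-degenerate simplex $S\subset\mathbb R^d$ satisfies $$0<\gamma_d(S)<\tfrac12 .$$ Moreover, for every $h\in(0,1/2)$ there exists a non-degenerate simplex $S\subset\mathbb R^d$ such that $\gamma_d(S)=h$. -/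

import Mathlib

open MeasureTheory Metric

namespace SolidAngle

/-- The uniform distribution on the unit sphere of `ℝᵈ`: the normalized surface measure. -/
noncomputable def uniformSphere (d : ℕ) :
    Measure (sphere (0 : EuclideanSpace ℝ (Fin d)) 1) :=
  ((volume : Measure (EuclideanSpace ℝ (Fin d))).toSphere Set.univ)⁻¹ •
    (volume : Measure (EuclideanSpace ℝ (Fin d))).toSphere

/-- For `d ≥ 1` this is a probability measure. -/
theorem isProbabilityMeasure_uniformSphere (d : ℕ) [NeZero d] :
    IsProbabilityMeasure (uniformSphere d) := by
  have : Nonempty (Fin d) := ⟨0⟩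
  have h0 : (volume : Measure (EuclideanSpace ℝ (Fin d))).toSphere ≠ 0 :=
    Measure.toSphere_ne_zero _
  constructor
  simp only [uniformSphere, Measure.smul_apply, smul_eq_mul]
  exact ENNReal.inv_mul_cancel (Measure.measure_univ_ne_zero.2 h0) (measure_ne_top _ _)

/-- The solid angle `α_d(C) = ℙ[Z ∈ C]` of a set `C ⊆ ℝᵈ` (meant for cones), where `Z` is uniformly
distributed on the unit sphere; the full solid angle is `1`. -/
noncomputable def solidAngle {d : ℕ} (C : Set (EuclideanSpace ℝ (Fin d))) : ℝ :=
  (uniformSphere d).real {z | (z : EuclideanSpace ℝ (Fin d)) ∈ C}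

/-- The cone `pos(x₀ - xᵢ, …, x_d - xᵢ)` spanned by a simplex at its `i`-th vertex. -/
def vertexCone {d : ℕ} (S : Affine.Simplex ℝ (EuclideanSpace ℝ (Fin d)) d) (i : Fin (d + 1)) :
    PointedCone ℝ (EuclideanSpace ℝ (Fin d)) :=
  PointedCone.hull ℝ (Set.range fun j : Fin (d + 1) => S.points j - S.points i)

/-- The sum `γ_d(S)` of the solid angles of a simplex at its vertices. -/
noncomputable def angleSum {d : ℕ} (S : Affine.Simplex ℝ (EuclideanSpace ℝ (Fin d)) d) : ℝ :=
  ∑ i : Fin (d + 1), solidAngle (vertexCone S i : Set (EuclideanSpace ℝ (Fin d)))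

/-- A simplex is non-degenerate if, as the convex hull of its vertices, it has non-empty
interior. -/
def NonDegenerate {d : ℕ} (S : Affine.Simplex ℝ (EuclideanSpace ℝ (Fin d)) d) : Prop :=
  (interior (convexHull ℝ (Set.range S.points))).Nonempty

end SolidAngle

/-! Let `φ j` be the linear parts of the barycentric coordinates; they sum to zero. The cone at
vertex `i` is `φ j ≥ 0` for all `j ≠ i` (`hull_eq`), and boundaries are null, so `γ_d` is the total
angle of the open cones `openCone φ i`, where every sign except the `i`-th is `+`; the `i`-th must
then be `-`. These cones are disjoint. Their union `U` is disjoint from `-U`, and both miss the open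
set where two coordinates are positive and two negative, which is non-empty since `d + 1 ≥ 4`. Hence
`2 γ_d < 1`.

For the converse, any `d` independent functionals, completed to sum zero, come from a simplex
(`exists_simplex_isDirectionCoord`). The angle sum is continuous in the functionals even where they
become dependent, provided none vanishes. A path whose ends are collinear systems with angle sums
`1/2` and `0` then yields every intermediate value. -/

open Set Filter Topology Pointwise

namespace SolidAngle

/-! ### Solid angle as a measure on cones -/

section Measure

variable {d : ℕ}

/-- The uniform distribution on the sphere does not charge hyperplanes. -/
theorem ae_linearMap_ne_zero (φ : EuclideanSpace ℝ (Fin d) →ₗ[ℝ] ℝ) (hφ : φ ≠ 0) :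
    ∀ᵐ z : sphere (0 : EuclideanSpace ℝ (Fin d)) 1 ∂uniformSphere d, φ z ≠ 0 := by
  have hker : volume (LinearMap.ker φ : Set (EuclideanSpace ℝ (Fin d))) = 0 :=
    Measure.addHaar_submodule _ _ fun h => hφ (LinearMap.ker_eq_top.1 h)
  have hc : Continuous φ := φ.continuous_of_finiteDimensional
  have hm : MeasurableSet {z : sphere (0 : EuclideanSpace ℝ (Fin d)) 1 | φ z = 0} :=
    (isClosed_eq (hc.comp continuous_subtype_val) continuous_const).measurableSet
  rw [ae_iff]
  simp only [not_not, uniformSphere, Measure.smul_apply, smul_eq_mul]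
  rw [Measure.toSphere_apply' _ hm, measure_mono_null _ hker]
  · simp
  · rintro _ ⟨r, -, _, ⟨z, hz, rfl⟩, rfl⟩
    have hz' : φ z = 0 := hz
    simp [hz']

theorem uniformSphere_preimage_neg {A : Set (sphere (0 : EuclideanSpace ℝ (Fin d)) 1)}
    (hA : MeasurableSet A) : uniformSphere d ((fun z => -z) ⁻¹' A) = uniformSphere d A := by
  simp only [uniformSphere, Measure.smul_apply, smul_eq_mul]
  rw [Measure.toSphere_apply' _ hA, Measure.toSphere_apply' _ (continuous_neg.measurable hA)]
  have : Ioo (0 : ℝ) 1 • ((↑) '' ((fun z => -z) ⁻¹' A) : Set (EuclideanSpace ℝ (Fin d))) =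
      -(Ioo (0 : ℝ) 1 • ((↑) '' A)) := by
    ext x
    simp only [Set.mem_neg, Set.mem_smul, Set.mem_image, Set.mem_preimage]
    constructor
    · rintro ⟨r, hr, _, ⟨z, hz, rfl⟩, rfl⟩
      exact ⟨r, hr, _, ⟨-z, hz, rfl⟩, by simp⟩
    · rintro ⟨r, hr, _, ⟨z, hz, rfl⟩, h⟩
      exact ⟨r, hr, _, ⟨-z, by simpa using hz, rfl⟩, by simp [h]⟩
  rw [this, Measure.measure_neg]

theorem solidAngle_neg {C : Set (EuclideanSpace ℝ (Fin d))} (hC : MeasurableSet C) :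
    solidAngle (-C) = solidAngle C :=
  congrArg ENNReal.toReal (uniformSphere_preimage_neg (measurable_subtype_coe hC))

theorem solidAngle_congr {C D : Set (EuclideanSpace ℝ (Fin d))}
    (h : ∀ᵐ z : sphere (0 : EuclideanSpace ℝ (Fin d)) 1 ∂uniformSphere d,
      (z : EuclideanSpace ℝ (Fin d)) ∈ C ↔ ↑z ∈ D) :
    solidAngle C = solidAngle D :=
  measureReal_congr (eventuallyEq_set.2 h)

/-- An open cone that contains a non-zero vector has positive solid angle. -/
theorem solidAngle_pos [NeZero d] {C : Set (EuclideanSpace ℝ (Fin d))} (hC : IsOpen C)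
    (hcone : ∀ r : ℝ, 0 < r → ∀ z ∈ C, r • z ∈ C) {z : EuclideanSpace ℝ (Fin d)} (hz : z ∈ C)
    (hz0 : z ≠ 0) : 0 < solidAngle C := by
  have := isProbabilityMeasure_uniformSphere d
  have hn : 0 < ‖z‖ := norm_pos_iff.2 hz0
  have hopen : IsOpen {w : sphere (0 : EuclideanSpace ℝ (Fin d)) 1 | ↑w ∈ C} :=
    hC.preimage continuous_subtype_val
  have hne : {w : sphere (0 : EuclideanSpace ℝ (Fin d)) 1 | ↑w ∈ C}.Nonempty :=
    ⟨⟨‖z‖⁻¹ • z, by simp [norm_smul, hn.ne']⟩, hcone _ (inv_pos.2 hn) z hz⟩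
  refine ENNReal.toReal_pos ?_ (measure_ne_top _ _)
  simp only [uniformSphere, Measure.smul_apply, smul_eq_mul]
  exact mul_ne_zero (ENNReal.inv_ne_zero.2 (measure_ne_top _ _)) (hopen.measure_ne_zero _ hne)

theorem solidAngle_empty : solidAngle (∅ : Set (EuclideanSpace ℝ (Fin d))) = 0 := by
  simp [solidAngle]

theorem solidAngle_univ [NeZero d] : solidAngle (univ : Set (EuclideanSpace ℝ (Fin d))) = 1 := by
  have := isProbabilityMeasure_uniformSphere d
  simp [solidAngle]

theorem solidAngle_le_one [NeZero d] (C : Set (EuclideanSpace ℝ (Fin d))) : solidAngle C ≤ 1 := by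
  have := isProbabilityMeasure_uniformSphere d
  exact measureReal_le_one

theorem solidAngle_union [NeZero d] {C D : Set (EuclideanSpace ℝ (Fin d))} (hCD : Disjoint C D)
    (hD : MeasurableSet D) : solidAngle (C ∪ D) = solidAngle C + solidAngle D := by
  have := isProbabilityMeasure_uniformSphere d
  exact measureReal_union (hCD.preimage _) (measurable_subtype_coe hD)

theorem solidAngle_iUnion [NeZero d] {ι : Type*} [Fintype ι]
    {C : ι → Set (EuclideanSpace ℝ (Fin d))} (hC : Pairwise fun i j => Disjoint (C i) (C j))
    (hm : ∀ i, MeasurableSet (C i)) : solidAngle (⋃ i, C i) = ∑ i, solidAngle (C i) := by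
  have := isProbabilityMeasure_uniformSphere d
  have hpre : {z : sphere (0 : EuclideanSpace ℝ (Fin d)) 1 | ↑z ∈ ⋃ i, C i} =
      ⋃ i, (↑) ⁻¹' C i := preimage_iUnion
  rw [solidAngle, hpre]
  exact measureReal_iUnion_fintype (fun i j hij => (hC hij).preimage _)
    fun i => measurable_subtype_coe (hm i)

/-- An open half-space bounded by a hyperplane through the origin has solid angle one half. -/
theorem solidAngle_halfSpace [NeZero d] (φ : EuclideanSpace ℝ (Fin d) →ₗ[ℝ] ℝ) (hφ : φ ≠ 0) :
    solidAngle {z | 0 < φ z} = 1 / 2 := by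
  have hc : Continuous φ := φ.continuous_of_finiteDimensional
  have hm : MeasurableSet {z | 0 < φ z} := (isOpen_lt continuous_const hc).measurableSet
  have hneg : solidAngle (-{z | 0 < φ z}) = solidAngle {z | 0 < φ z} := solidAngle_neg hm
  have hd : Disjoint {z | 0 < φ z} (-{z | 0 < φ z}) := by
    rw [Set.disjoint_left]
    intro z hz hz'
    simp only [Set.mem_neg, mem_ofPred_eq, map_neg] at hz hz'
    linarith
  have hu := solidAngle_union hd hm.neg
  have h1 : solidAngle ({z | 0 < φ z} ∪ -{z | 0 < φ z}) = 1 := by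
    rw [← solidAngle_univ (d := d)]
    refine solidAngle_congr ?_
    filter_upwards [ae_linearMap_ne_zero φ hφ] with z hz
    simpa using hz.lt_or_gt.symm
  linarith

end Measure

/-! ### Cones cut out by sign conditions -/

section SignCone

variable {d : ℕ} {ι : Type*}

/-- The open cone on which all the functionals `φ j`, except possibly `φ i`, are positive. -/
def openCone (φ : ι → EuclideanSpace ℝ (Fin d) →ₗ[ℝ] ℝ) (i : ι) :
    Set (EuclideanSpace ℝ (Fin d)) :=
  {z | ∀ j, j ≠ i → 0 < φ j z}

theorem isOpen_openCone [Finite ι] (φ : ι → EuclideanSpace ℝ (Fin d) →ₗ[ℝ] ℝ) (i : ι) :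
    IsOpen (openCone φ i) := by
  simp only [openCone, ofPred_forall]
  exact isOpen_iInter_of_finite fun j => isOpen_iInter_of_finite fun _ =>
    isOpen_lt continuous_const (φ j).continuous_of_finiteDimensional

theorem smul_mem_openCone (φ : ι → EuclideanSpace ℝ (Fin d) →ₗ[ℝ] ℝ) (i : ι) (r : ℝ) (hr : 0 < r)
    (z : EuclideanSpace ℝ (Fin d)) (hz : z ∈ openCone φ i) : r • z ∈ openCone φ i := fun j hj => by
  simpa using mul_pos hr (hz j hj)

theorem solidAngle_openCone_eq [Finite ι] (φ : ι → EuclideanSpace ℝ (Fin d) →ₗ[ℝ] ℝ)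
    (hφ : ∀ j, φ j ≠ 0) (i : ι) :
    solidAngle {z | ∀ j, j ≠ i → 0 ≤ φ j z} = solidAngle (openCone φ i) := by
  refine solidAngle_congr ?_
  filter_upwards [ae_all_iff.2 fun j => ae_linearMap_ne_zero (φ j) (hφ j)] with z hz
  exact forall₂_congr fun j _ => ⟨fun h => h.lt_of_ne' (hz j), le_of_lt⟩

/-- The solid angle of a cone cut out by finitely many functionals depends continuously on these,
as long as none of them vanishes. -/
theorem continuousAt_solidAngle_openCone [NeZero d] [Finite ι] {X : Type*} [TopologicalSpace X]
    [FirstCountableTopology X] {φ : X → ι → EuclideanSpace ℝ (Fin d) →ₗ[ℝ] ℝ} {x : X}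
    (hφ : ∀ j z, ContinuousAt (fun y => φ y j z) x) (h0 : ∀ j, φ x j ≠ 0) (i : ι) :
    ContinuousAt (fun y => solidAngle (openCone (φ y) i)) x := by
  have := isProbabilityMeasure_uniformSphere d
  have hm (y : X) : MeasurableSet {z : sphere (0 : EuclideanSpace ℝ (Fin d)) 1 |
      ↑z ∈ openCone (φ y) i} :=
    measurable_subtype_coe (isOpen_openCone (φ y) i).measurableSet
  refine (ENNReal.tendsto_toReal (measure_ne_top _ _)).comp
    (tendsto_measure_of_ae_tendsto_indicator_of_isFiniteMeasure (𝓝 x) (hm x) hm ?_)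
  filter_upwards [ae_all_iff.2 fun j => ae_linearMap_ne_zero (φ x j) (h0 j)] with z hz
  -- Off the null set where some `φ x j` vanishes, each sign is locally constant in the parameter,
  -- so the indicators converge almost everywhere.
  have hev : ∀ j, ∀ᶠ y in 𝓝 x, (0 < φ y j z ↔ 0 < φ x j z) := by
    intro j
    rcases (hz j).lt_or_gt with h | h
    · filter_upwards [(hφ j z).eventually_lt_const h] with y hy
      exact ⟨fun h' => absurd h' hy.not_gt, fun h' => absurd h' h.not_gt⟩
    · filter_upwards [(hφ j z).eventually_const_lt h] with y hy
      exact ⟨fun _ => h, fun _ => hy⟩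
  filter_upwards [eventually_all.2 hev] with y hy
  exact forall₂_congr fun j _ => hy j

end SignCone

/-! ### Barycentric direction coordinates and the bounds on the angle sum -/

section Simplex

variable {d : ℕ}

/-- `φ` gives the barycentric coordinates, with sum zero, of the directions in the affine span of
the points `x`. -/
structure IsDirectionCoord (x : Fin (d + 1) → EuclideanSpace ℝ (Fin d))
    (φ : Fin (d + 1) → EuclideanSpace ℝ (Fin d) →ₗ[ℝ] ℝ) : Prop where
  apply_sub : ∀ j k i, φ j (x k - x i) = (if j = k then 1 else 0) - (if j = i then 1 else 0)
  sum_eq_zero : ∀ z, ∑ j, φ j z = 0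
  sum_smul : ∀ z, ∑ j, φ j z • x j = z

theorem exists_isDirectionCoord (S : Affine.Simplex ℝ (EuclideanSpace ℝ (Fin d)) d) :
    ∃ φ, IsDirectionCoord S.points φ := by
  have htop : affineSpan ℝ (range S.points) = ⊤ := by
    rw [S.independent.affineSpan_eq_top_iff_card_eq_finrank_add_one]
    simp
  let b : AffineBasis (Fin (d + 1)) ℝ (EuclideanSpace ℝ (Fin d)) :=
    ⟨S.points, S.independent, htop⟩
  have key (j : Fin (d + 1)) (z w : EuclideanSpace ℝ (Fin d)) :
      (b.coord j).linear (z - w) = b.coord j z - b.coord j w :=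
    (b.coord j).linearMap_vsub z w
  have key' (j : Fin (d + 1)) (z : EuclideanSpace ℝ (Fin d)) :
      (b.coord j).linear z = b.coord j z - b.coord j 0 := by
    simpa using key j z 0
  refine ⟨fun j => (b.coord j).linear, fun j k i => ?_, fun z => ?_, fun z => ?_⟩
  · change (b.coord j).linear (b k - b i) = _
    rw [key, b.coord_apply, b.coord_apply]
  · simp only [key', Finset.sum_sub_distrib, b.sum_coord_apply_eq_one, sub_self]
  · change ∑ j, (b.coord j).linear z • b j = z
    simp only [key', sub_smul, Finset.sum_sub_distrib, b.linear_combination_coord_eq_self, sub_zero]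

namespace IsDirectionCoord

variable {x : Fin (d + 1) → EuclideanSpace ℝ (Fin d)}
  {φ : Fin (d + 1) → EuclideanSpace ℝ (Fin d) →ₗ[ℝ] ℝ} (h : IsDirectionCoord x φ)

include h

theorem apply_sum (m : Fin (d + 1) → ℝ) (hm : ∑ k, m k = 0) (j : Fin (d + 1)) :
    φ j (∑ k, m k • x k) = m j := by
  have hx : ∑ k, m k • x k = ∑ k, m k • (x k - x 0) := by
    simp only [smul_sub, Finset.sum_sub_distrib, ← Finset.sum_smul, hm, zero_smul, sub_zero]
  rw [hx, map_sum]
  simp only [map_smul, h.apply_sub, smul_eq_mul, mul_sub, Finset.sum_sub_distrib, ← Finset.sum_mul,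
    hm]
  simp

theorem affineIndependent : AffineIndependent ℝ x := by
  rw [affineIndependent_iff_of_fintype]
  intro w hw h0 i
  rw [Finset.univ.weightedVSub_eq_linear_combination hw] at h0
  rw [← h.apply_sum w hw i, h0, map_zero]

theorem ne_zero [NeZero d] (j : Fin (d + 1)) : φ j ≠ 0 := by
  obtain ⟨i, hi⟩ : ∃ i, i ≠ j := exists_ne j
  intro h0
  have := h.apply_sub j j i
  simp [h0, hi.symm] at this

/-- Since the coordinates sum to zero, `z = ∑ j, φ j z • (x j - x i)`. The `i`-th term is zero, so
the sign of `φ i z` plays no role. -/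
theorem hull_eq (i : Fin (d + 1)) :
    (PointedCone.hull ℝ (range fun j => x j - x i) : Set (EuclideanSpace ℝ (Fin d))) =
      {z | ∀ j, j ≠ i → 0 ≤ φ j z} := by
  ext z
  simp only [SetLike.mem_coe, mem_ofPred_eq]
  constructor
  · intro hz j hj
    induction hz using Submodule.span_induction with
    | mem z hz =>
      obtain ⟨k, rfl⟩ := hz
      simp only [h.apply_sub, hj, if_false, sub_zero]
      split_ifs <;> norm_num
    | zero => simp
    | add z w _ _ hz hw => simpa using add_nonneg hz hw
    | smul r z _ hz =>
      change 0 ≤ φ j ((r : ℝ) • z)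
      rw [map_smul]
      exact mul_nonneg r.2 hz
  · intro hz
    have hsum : z = ∑ j, φ j z • (x j - x i) := by
      simp only [smul_sub, Finset.sum_sub_distrib, ← Finset.sum_smul, h.sum_eq_zero, zero_smul,
        sub_zero, h.sum_smul]
    rw [hsum]
    refine Submodule.sum_mem _ fun j _ => ?_
    rcases eq_or_ne j i with rfl | hj
    · simp
    · exact Submodule.smul_mem _ (⟨φ j z, hz j hj⟩ : {c : ℝ // 0 ≤ c})
        (Submodule.subset_span (mem_range_self j))


theorem apply_neg_of_mem [NeZero d] {i : Fin (d + 1)} {z : EuclideanSpace ℝ (Fin d)}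
    (hz : z ∈ openCone φ i) : φ i z < 0 := by
  have hs := h.sum_eq_zero z
  rw [← Finset.add_sum_erase _ _ (Finset.mem_univ i)] at hs
  have hp : 0 < ∑ j ∈ Finset.univ.erase i, φ j z := by
    refine Finset.sum_pos (fun j hj => hz j (Finset.ne_of_mem_erase hj)) ?_
    obtain ⟨j, hj⟩ := exists_ne i
    exact ⟨j, by simp [hj]⟩
  linarith

theorem sum_solidAngle_pos [NeZero d] : 0 < ∑ i, solidAngle (openCone φ i) := by
  refine Finset.sum_pos (fun i _ => ?_) Finset.univ_nonempty
  let m : Fin (d + 1) → ℝ := fun j => if j = i then -d else 1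
  have hm : ∑ k, m k = 0 := by
    rw [← Finset.add_sum_erase _ _ (Finset.mem_univ i),
      Finset.sum_congr rfl (g := fun _ => (1 : ℝ))
        fun j hj => if_neg (Finset.ne_of_mem_erase hj)]
    simp [m]
  have hz : ∑ k, m k • x k ∈ openCone φ i := fun j hj => by
    rw [h.apply_sum m hm]
    simp [m, hj]
  refine solidAngle_pos (isOpen_openCone φ i) (smul_mem_openCone φ i) hz fun h0 => ?_
  rw [h0] at hz
  obtain ⟨j, hj⟩ := exists_ne i
  simpa using hz j hj

theorem sum_solidAngle_lt (hd : 3 ≤ d) : ∑ i, solidAngle (openCone φ i) < 1 / 2 := by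
  have : NeZero d := ⟨by omega⟩
  have hopen := isOpen_openCone φ
  have hdisj : Pairwise fun i j => Disjoint (openCone φ i) (openCone φ j) := by
    intro i j hij
    rw [Set.disjoint_left]
    intro z hz hz'
    exact (h.apply_neg_of_mem hz).not_gt (hz' i hij)
  rw [← solidAngle_iUnion hdisj fun i => (hopen i).measurableSet]
  set U := ⋃ i, openCone φ i with hU
  have hUo : IsOpen U := isOpen_iUnion hopen
  obtain ⟨a, b, c, e, hab, hac, hae, hbc, hbe, hce⟩ :
      ∃ a b c e : Fin (d + 1), a ≠ b ∧ a ≠ c ∧ a ≠ e ∧ b ≠ c ∧ b ≠ e ∧ c ≠ e :=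
    ⟨⟨0, by omega⟩, ⟨1, by omega⟩, ⟨2, by omega⟩, ⟨3, by omega⟩, by simp⟩
  let V := {z | 0 < φ a z ∧ 0 < φ b z ∧ φ c z < 0 ∧ φ e z < 0}
  have hc (j) : Continuous (φ j) := (φ j).continuous_of_finiteDimensional
  have hVo : IsOpen V :=
    (isOpen_lt continuous_const (hc a)).inter <| (isOpen_lt continuous_const (hc b)).inter <|
      (isOpen_lt (hc c) continuous_const).inter (isOpen_lt (hc e) continuous_const)
  have hVpos : 0 < solidAngle V := by
    -- Any coordinates with sum zero are attained, so two plus and two minus signs do occur.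
    let m : Fin (d + 1) → ℝ := Pi.single a 1 + Pi.single b 1 - Pi.single c 1 - Pi.single e 1
    have hm : ∑ k, m k = 0 := by
      simp [m, Finset.sum_sub_distrib, Finset.sum_add_distrib]
    have hz : ∑ k, m k • x k ∈ V := by
      refine ⟨?_, ?_, ?_, ?_⟩ <;> rw [h.apply_sum m hm] <;>
        simp [m, hab, hac, hae, hbc, hbe, hce, hab.symm, hac.symm, hae.symm, hbc.symm, hbe.symm,
          hce.symm]
    refine solidAngle_pos hVo (fun r hr z hz => ?_) hz fun h0 => ?_
    · obtain ⟨h1, h2, h3, h4⟩ := hz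
      refine ⟨?_, ?_, ?_, ?_⟩ <;> rw [map_smul, smul_eq_mul]
      exacts [mul_pos hr h1, mul_pos hr h2, mul_neg_of_pos_of_neg hr h3,
        mul_neg_of_pos_of_neg hr h4]
    · rw [h0] at hz
      simpa using hz.1
  have hUU : Disjoint U (-U) := by
    rw [Set.disjoint_left]
    intro z hz hz'
    obtain ⟨i, hi⟩ := mem_iUnion.1 hz
    obtain ⟨k, hk⟩ := mem_iUnion.1 (Set.mem_neg.1 hz')
    -- A third index would need `φ j z` to be both positive and negative.
    obtain ⟨j, hji, hjk⟩ : ∃ j, j ≠ i ∧ j ≠ k := by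
      by_contra! hcon
      have hor (j) : j = i ∨ j = k := or_iff_not_imp_left.2 (hcon j)
      rcases hor a with h1 | h1 <;> rcases hor b with h2 | h2 <;> rcases hor c with h3 | h3 <;>
        first
        | exact hab (h1.trans h2.symm)
        | exact hac (h1.trans h3.symm)
        | exact hbc (h2.trans h3.symm)
    have h1 := hi j hji
    have h2 := hk j hjk
    rw [map_neg] at h2
    linarith
  have hUV : Disjoint (U ∪ -U) V := by
    rw [Set.disjoint_left]
    rintro z (hz | hz) ⟨h1, h2, h3, h4⟩
    · obtain ⟨i, hi⟩ := mem_iUnion.1 hz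
      have hci : c = i := by_contra fun hne => (hi c hne).not_gt h3
      exact (hi e (hci ▸ hce.symm)).not_gt h4
    · obtain ⟨i, hi⟩ := mem_iUnion.1 (Set.mem_neg.1 hz)
      have hneg (j) (hj : j ≠ i) : φ j z < 0 := by simpa using hi j hj
      have hai : a = i := by_contra fun hne => (hneg a hne).not_gt h1
      exact (hneg b (hai ▸ hab.symm)).not_gt h2
  have hle := solidAngle_le_one (U ∪ -U ∪ V)
  rw [solidAngle_union hUV hVo.measurableSet, solidAngle_union hUU hUo.measurableSet.neg,
    solidAngle_neg hUo.measurableSet] at hle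
  linarith

end IsDirectionCoord

theorem angleSum_eq [NeZero d] (S : Affine.Simplex ℝ (EuclideanSpace ℝ (Fin d)) d)
    {φ : Fin (d + 1) → EuclideanSpace ℝ (Fin d) →ₗ[ℝ] ℝ} (h : IsDirectionCoord S.points φ) :
    angleSum S = ∑ i, solidAngle (openCone φ i) := by
  refine Finset.sum_congr rfl fun i _ => ?_
  rw [← solidAngle_openCone_eq φ h.ne_zero, ← h.hull_eq]
  rfl

theorem nonDegenerate (S : Affine.Simplex ℝ (EuclideanSpace ℝ (Fin d)) d) : NonDegenerate S := by
  rw [NonDegenerate, interior_convexHull_nonempty_iff_affineSpan_eq_top,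
    S.independent.affineSpan_eq_top_iff_card_eq_finrank_add_one]
  simp

/-- The functionals `-∑ j, ψ j` and `ψ j`, whose sum is zero. -/
def extendSumZero (ψ : Fin d → EuclideanSpace ℝ (Fin d) →ₗ[ℝ] ℝ) :
    Fin (d + 1) → EuclideanSpace ℝ (Fin d) →ₗ[ℝ] ℝ :=
  Fin.cons (-∑ j, ψ j) ψ

/-- The vertices are the origin and the basis dual to `ψ`. -/
theorem exists_simplex_isDirectionCoord (ψ : Fin d → EuclideanSpace ℝ (Fin d) →ₗ[ℝ] ℝ)
    (hψ : ∀ z, (∀ j, ψ j z = 0) → z = 0) :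
    ∃ S : Affine.Simplex ℝ (EuclideanSpace ℝ (Fin d)) d,
      IsDirectionCoord S.points (extendSumZero ψ) := by
  have hinj : Function.Injective (LinearMap.pi ψ) := by
    rw [← LinearMap.ker_eq_bot, LinearMap.ker_eq_bot']
    exact fun z hz => hψ z fun j => congrFun hz j
  let e := LinearEquiv.ofInjectiveOfFinrankEq (LinearMap.pi ψ) hinj (by simp)
  have he (z j) : e z j = ψ j z := rfl
  let y : Fin d → EuclideanSpace ℝ (Fin d) := fun k => e.symm (Pi.single k 1)
  have hy (j k) : ψ j (y k) = if j = k then 1 else 0 := by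
    rw [← he, e.apply_symm_apply, Pi.single_apply]
  let x : Fin (d + 1) → EuclideanSpace ℝ (Fin d) := Fin.cons 0 y
  have hx (j k : Fin (d + 1)) : extendSumZero ψ j (x k) =
      (if j = k then 1 else 0) - (if j = 0 then 1 else 0) := by
    refine Fin.cases ?_ (fun j => ?_) j <;> refine Fin.cases ?_ (fun k => ?_) k <;>
      simp [x, extendSumZero, hy, Fin.succ_ne_zero, (Fin.succ_ne_zero _).symm]
  have hxφ : IsDirectionCoord x (extendSumZero ψ) := by
    refine ⟨fun j k i => ?_, fun z => ?_, fun z => ?_⟩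
    · rw [map_sub, hx, hx]
      ring
    · simp [Fin.sum_univ_succ, extendSumZero]
    · apply e.injective
      ext j
      rw [he, he, map_sum, Fin.sum_univ_succ]
      simp [extendSumZero, x, hy]
  exact ⟨⟨x, hxφ.affineIndependent⟩, hxφ⟩

end Simplex

/-! ### A path of functionals from angle sum `1/2` to angle sum `0` -/

section Path

variable {n : ℕ}

/-- The functionals `z ↦ t (1 - t) zⱼ + c z₀`, with `c = 1 - 2 t` for the last index `j` and
`c = 1` otherwise: a path between two systems of multiples of the coordinate `z₀`. -/
noncomputable def pathFunctional (t : ℝ) (j : Fin (n + 1)) :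
    EuclideanSpace ℝ (Fin (n + 1)) →ₗ[ℝ] ℝ :=
  (t * (1 - t)) • (EuclideanSpace.proj j : EuclideanSpace ℝ (Fin (n + 1)) →L[ℝ] ℝ).toLinearMap +
    (if j = Fin.last n then 1 - 2 * t else 1) •
      (EuclideanSpace.proj 0 : EuclideanSpace ℝ (Fin (n + 1)) →L[ℝ] ℝ).toLinearMap

theorem pathFunctional_apply (t : ℝ) (j : Fin (n + 1)) (z : EuclideanSpace ℝ (Fin (n + 1))) :
    pathFunctional t j z = t * (1 - t) * z j + (if j = Fin.last n then 1 - 2 * t else 1) * z 0 := by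
  split_ifs with hj <;> simp [pathFunctional, hj]

theorem sum_pathFunctional_weights (t : ℝ) :
    ∑ j : Fin (n + 1), (if j = Fin.last n then 1 - 2 * t else 1) = n + 1 - 2 * t := by
  simp [Fin.sum_univ_castSucc, Fin.castSucc_ne_last]
  ring

theorem pathFunctional_injective (hn : 1 ≤ n) {t : ℝ} (ht0 : 0 < t) (ht1 : t < 1)
    (z : EuclideanSpace ℝ (Fin (n + 1))) (hz : ∀ j, pathFunctional t j z = 0) : z = 0 := by
  have hs : 0 < t * (1 - t) := mul_pos ht0 (by linarith)
  have h0 : z 0 = 0 := by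
    have := hz 0
    have hne : (0 : Fin (n + 1)) ≠ Fin.last n := by simp [Fin.ext_iff]; omega
    rw [pathFunctional_apply, if_neg hne, ← add_mul] at this
    -- At index `0` the two terms merge into the coefficient `t (1 - t) + 1 > 0`.
    exact (mul_eq_zero.1 this).resolve_left (by linarith)
  ext j
  have := hz j
  rw [pathFunctional_apply, h0, mul_zero, add_zero] at this
  exact (mul_eq_zero.1 this).resolve_left hs.ne'

theorem continuous_extendSumZero_pathFunctional (j : Fin (n + 1 + 1))
    (z : EuclideanSpace ℝ (Fin (n + 1))) :
    Continuous fun t => extendSumZero (pathFunctional t) j z := by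
  have hc (j : Fin (n + 1)) : Continuous fun t => pathFunctional t j z := by
    simp only [pathFunctional_apply]
    split_ifs <;> fun_prop
  refine Fin.cases ?_ (fun j => ?_) j
  · simp only [extendSumZero, Fin.cons_zero, LinearMap.neg_apply, LinearMap.sum_apply]
    exact (continuous_finsetSum _ fun j _ => hc j).neg
  · simpa only [extendSumZero, Fin.cons_succ] using hc j

theorem extendSumZero_pathFunctional_endpoint {t : ℝ} (ht : t * (1 - t) = 0)
    (z : EuclideanSpace ℝ (Fin (n + 1))) :
    extendSumZero (pathFunctional t) 0 z = -((n + 1 - 2 * t) * z 0) ∧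
      ∀ j : Fin (n + 1), extendSumZero (pathFunctional t) j.succ z =
        (if j = Fin.last n then 1 - 2 * t else 1) * z 0 := by
  constructor
  · simp only [extendSumZero, Fin.cons_zero, LinearMap.neg_apply, LinearMap.sum_apply,
      pathFunctional_apply, ht, zero_mul, zero_add, ← Finset.sum_mul, sum_pathFunctional_weights]
  · intro j
    simp only [extendSumZero, Fin.cons_succ, pathFunctional_apply, ht, zero_mul, zero_add]

theorem extendSumZero_pathFunctional_ne_zero (hn : 2 ≤ n) {t : ℝ} (ht : t ∈ Icc (0 : ℝ) 1)
    (j : Fin (n + 1 + 1)) : extendSumZero (pathFunctional (n := n) t) j ≠ 0 := by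
  have hn' : (2 : ℝ) ≤ n := by exact_mod_cast hn
  -- At the endpoints all functionals are multiples of `z 0`, with non-zero factors because `n ≥ 2`;
  -- in between they belong to a simplex.
  by_cases hs : t * (1 - t) = 0
  · intro h0
    have h := extendSumZero_pathFunctional_endpoint hs (EuclideanSpace.single (0 : Fin (n + 1)) 1)
    revert h0
    refine Fin.cases (fun h0 => ?_) (fun j h0 => ?_) j
    · have := h.1
      simp only [h0, LinearMap.zero_apply, PiLp.single_apply, if_true, mul_one] at this
      linarith [ht.2]
    · have := h.2 j
      simp only [h0, LinearMap.zero_apply, PiLp.single_apply, if_true, mul_one] at this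
      rcases mul_eq_zero.1 hs with h1 | h1 <;> split_ifs at this <;> linarith
  · have ht0 : 0 < t := ht.1.lt_of_ne (by rintro rfl; simp at hs)
    have ht1 : t < 1 := ht.2.lt_of_ne (by rintro rfl; simp at hs)
    obtain ⟨S, hS⟩ := exists_simplex_isDirectionCoord (pathFunctional (n := n) t)
      (pathFunctional_injective (by omega) ht0 ht1)
    exact hS.ne_zero j

/-- The sum of the solid angles along the path. -/
noncomputable def pathAngleSum (n : ℕ) (t : ℝ) : ℝ :=
  ∑ i, solidAngle (openCone (extendSumZero (pathFunctional (n := n) t)) i)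

theorem continuousOn_pathAngleSum (hn : 2 ≤ n) : ContinuousOn (pathAngleSum n) (Icc 0 1) := by
  intro t ht
  refine ContinuousAt.continuousWithinAt (tendsto_finsetSum _ fun i _ => ?_)
  exact continuousAt_solidAngle_openCone
    (fun j z => (continuous_extendSumZero_pathFunctional j z).continuousAt)
    (extendSumZero_pathFunctional_ne_zero hn ht) i

/-- The multiples of `z 0` have signs `-, +, …, +`: the cone omitting the first is a half-space, and
every other one is empty. -/
theorem pathAngleSum_zero (hn : 2 ≤ n) : pathAngleSum n 0 = 1 / 2 := by
  have h := extendSumZero_pathFunctional_endpoint (n := n) (t := 0) (by simp)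
  simp only [mul_zero, sub_zero, ite_self, one_mul] at h
  have hn1 : (0 : ℝ) < n + 1 := by positivity
  rw [pathAngleSum, Fin.sum_univ_succ, Finset.sum_eq_zero, add_zero]
  · let φ := (EuclideanSpace.proj 0 : EuclideanSpace ℝ (Fin (n + 1)) →L[ℝ] ℝ).toLinearMap
    have hφ : φ ≠ 0 := fun h0 => by
      simpa [φ] using LinearMap.congr_fun h0 (EuclideanSpace.single 0 1)
    rw [← solidAngle_halfSpace φ hφ]
    congr 1
    ext z
    constructor
    · intro hz
      have := hz (Fin.succ 0) (Fin.succ_ne_zero 0)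
      rwa [(h z).2] at this
    · intro hz j hj
      obtain ⟨j, rfl⟩ := Fin.exists_succ_eq.2 hj
      rw [(h z).2]
      exact hz
  · intro i _
    convert! solidAngle_empty
    refine eq_empty_of_forall_notMem fun z hz => ?_
    have : Nontrivial (Fin (n + 1)) := Fin.nontrivial_iff_two_le.2 (by omega)
    obtain ⟨j, hj⟩ := exists_ne i
    have h1 := hz 0 (Fin.succ_ne_zero i).symm
    have h2 := hz j.succ (by simpa using hj)
    rw [(h z).1] at h1
    rw [(h z).2] at h2
    have := mul_pos hn1 h2
    linarith

/-- The multiples of `z 0` have signs `-, +, …, +, -` with at least two of each, so omitting one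
functional still leaves contradictory conditions. -/
theorem pathAngleSum_one (hn : 2 ≤ n) : pathAngleSum n 1 = 0 := by
  have h := extendSumZero_pathFunctional_endpoint (n := n) (t := 1) (by simp)
  have hn1 : (0 : ℝ) < n + 1 - 2 * 1 := by
    have : (2 : ℝ) ≤ n := by exact_mod_cast hn
    linarith
  refine Finset.sum_eq_zero fun i _ => ?_
  convert! solidAngle_empty
  refine eq_empty_of_forall_notMem fun z hz => ?_
  let a : Fin (n + 1) := ⟨0, by omega⟩
  let b : Fin (n + 1) := ⟨1, by omega⟩
  have ha : extendSumZero (pathFunctional 1) a.succ z = z 0 := by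
    rw [(h z).2, if_neg (by simp [a, Fin.ext_iff]; omega), one_mul]
  have hb : extendSumZero (pathFunctional 1) b.succ z = z 0 := by
    rw [(h z).2, if_neg (by simp [b, Fin.ext_iff]; omega), one_mul]
  have hl : extendSumZero (pathFunctional 1) (Fin.last n).succ z = -z 0 := by
    rw [(h z).2, if_pos rfl]
    ring
  have hpos : 0 < z 0 := by
    by_cases hi : a.succ = i
    · rw [← hb]
      exact hz _ (by rw [← hi]; simp [a, b, Fin.ext_iff])
    · rw [← ha]
      exact hz _ hi
  by_cases hi : (0 : Fin (n + 1 + 1)) = i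
  · have := hz (Fin.last n).succ (by rw [← hi]; exact Fin.succ_ne_zero _)
    linarith
  · have := hz 0 hi
    rw [(h z).1] at this
    have := mul_pos hn1 hpos
    linarith

end Path

end SolidAngle

theorem proposition730 (d : ℕ) (hd : 3 ≤ d) :
    (∀ S : Affine.Simplex ℝ (EuclideanSpace ℝ (Fin d)) d, SolidAngle.NonDegenerate S →
      0 < SolidAngle.angleSum S ∧ SolidAngle.angleSum S < 1 / 2) ∧
    (∀ h : ℝ, 0 < h → h < 1 / 2 →
      ∃ S : Affine.Simplex ℝ (EuclideanSpace ℝ (Fin d)) d,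
        SolidAngle.NonDegenerate S ∧ SolidAngle.angleSum S = h) := by
  have : NeZero d := ⟨by omega⟩
  refine ⟨fun S _ => ?_, fun h h0 h1 => ?_⟩
  · obtain ⟨φ, hφ⟩ := SolidAngle.exists_isDirectionCoord S
    rw [SolidAngle.angleSum_eq S hφ]
    exact ⟨hφ.sum_solidAngle_pos, hφ.sum_solidAngle_lt hd⟩
  · obtain ⟨n, rfl⟩ : ∃ n, d = n + 1 := ⟨d - 1, by omega⟩
    have hn : 2 ≤ n := by omega
    -- The open-interval form keeps `t` off the endpoints, where no simplex exists.
    obtain ⟨t, ht, rfl⟩ := intermediate_value_Ioo' zero_le_one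
      (SolidAngle.continuousOn_pathAngleSum hn)
      (by rw [SolidAngle.pathAngleSum_one hn, SolidAngle.pathAngleSum_zero hn]; exact ⟨h0, h1⟩)
    obtain ⟨S, hS⟩ := SolidAngle.exists_simplex_isDirectionCoord
      (SolidAngle.pathFunctional (n := n) t)
      (SolidAngle.pathFunctional_injective (by omega) ht.1 ht.2)
    exact ⟨S, SolidAngle.nonDegenerate S, SolidAngle.angleSum_eq S hS⟩
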